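/- Let $\mathbb{H}$ be the quaternions, $\mathbb{S}=\{I\in\mathbb{H}: I^2=-1\}$ and, for $I\in\mathbb{S}$, $L_I=\mathbb{R}+I\mathbb{R}\cong\mathbb{C}$. A domain is a nonempty connected open subset of $\mathbb{H}$; for a domain $\Omega'$ put $\Omega'_I=\Omega'\cap L_I$. A domain $\Omega'$ is a symmetric slice domain if it meets $\mathbb{R}$, all $\Omega'_I$ are connected, and $x+Iy\in\Omega'$ implies $x+Jy\in\Omega'$ for all $x,y\in\mathbb{R}$ and $I,J\in\mathbb{S}$. A function $f:\Omega'\to\mathbb{H}$ is (slice) regular if, for every $I\in\mathbb{S}$, the restriction $f_I=f|_{\Omega'_I}$ is of class $C^1$ and $\frac12\left(\frac{\partial}{\partial x}+I\frac{\partial}{\partial y}\right)f_I(x+yI)=0$ on $\Omega'_I$. An upper semicontinuous function $v:D\to[-\infty,\infty)$ on an open set $D\subseteq\mathbb{C}$ is called subharmonic if, for every relatively compact open subset $G$ of $D$ and every real function $h$ that is continuous on $\overline G$ and harmonic in $G$, $v\le h$ on $\partial G$ implies $v\le h$ in $G$ (it may be identically $-\infty$ on components of $D$). Harmonic functions are real-valued,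 of class $C^2$, with vanishing Laplacian. Let $\Omega\subseteq\mathbb{H}$ be a domain and let $u:\Omega\to[-\infty,\infty)$ be upper semicontinuous and not identically $-\infty$. The function $u$ is strongly subharmonic if it is plurisubharmonic with respect to each constant orthogonal complex structure $v\mapsto Iv$, $I\in\mathbb{S}$, that is, if for all $I\in\mathbb{S}$, $a\in\Omega$, $b\in\mathbb{H}$ the function $\lambda\mapsto u(a+\lambda b)$ is subharmonic on $\{\lambda\in L_I: a+\lambda b\in\Omega\}$. It is strongly harmonic if it is pluriharmonic with respect to each of these structures, that is, if it is real-valued, of class $C^2$, and all these functions of $\lambda$ are harmonic. A function on a domain $\Omega'$ with values in $[-\infty,\infty)$ is slicewise subharmonic (respectively slicewise harmonic) if its restriction to $\Omega'_I\subseteq L_I\cong\mathbb{C}$ is subharmonic (respectively harmonic) for every $I\in\mathbb{S}$; it is weakly subharmonic (respectively weakly harmonic) if in addition it is upper semicontinuous on $\Omega'$. Theorem. The following are equivalent: 1. $u$ is strongly subharmonic; 2. for every domain $\Omega'$ and every regular function $f:\Omega'\to\Omega$, the composition $u\circ f$ is slicewise subharmonic; 3. for every symmetric slice domain $\Omega'$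 and every regular function $f:\Omega'\to\Omega$, the composition $u\circ f$ is weakly subharmonic. The same three statements with "subharmonic" replaced by "harmonic" throughout are equivalent as well. -/

import Mathlib

open scoped Quaternion

namespace Quat

/-- A domain: a nonempty connected open set. -/
def IsOpenDomain (Ω : Set ℍ) : Prop := IsOpen Ω ∧ IsConnected Ω

/-- The sphere `𝕊` of quaternionic imaginary units. -/
def imagUnits : Set ℍ := {q | q ^ 2 = -1}

/-- The identification `x + iy ↦ x + yI` of `ℂ` with the slice `L_I = ℝ + Iℝ`. -/
noncomputable def slice (I : ℍ) (z : ℂ) : ℍ := (z.re : ℍ) + (z.im : ℍ) * I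

/-- The part `Ω_I = Ω ∩ L_I` of `Ω` in the slice `L_I`, as a subset of `ℂ`. -/
def sliceSet (I : ℍ) (Ω : Set ℍ) : Set ℂ := slice I ⁻¹' Ω

/-- A symmetric slice domain: a domain that meets the real axis, has connected intersection with
every `L_I`, and is axially symmetric about the real axis. -/
structure IsSymmetricSliceDomain (Ω : Set ℍ) : Prop where
  isOpenDomain : IsOpenDomain Ω
  meets_real : ∃ x : ℝ, (x : ℍ) ∈ Ω
  connected_slice : ∀ I ∈ imagUnits, IsConnected (sliceSet I Ω)
  symmetric : ∀ I ∈ imagUnits, ∀ J ∈ imagUnits, ∀ z : ℂ, slice I z ∈ Ω → slice J z ∈ Ω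

/-- `f` is (slice) regular on the open set `Ω`: for every imaginary unit `I` the restriction `f_I`
is of class `C¹` and `(1/2) (∂/∂x + I ∂/∂y) f_I (x + yI) = 0`. -/
def RegularOn (f : ℍ → ℍ) (Ω : Set ℍ) : Prop :=
  ∀ I ∈ imagUnits,
    ContDiffOn ℝ 1 (fun z : ℂ => f (slice I z)) (sliceSet I Ω) ∧
    ∀ z ∈ sliceSet I Ω,
      (1 / 2 : ℝ) • (fderiv ℝ (fun w : ℂ => f (slice I w)) z 1 +
        I * fderiv ℝ (fun w : ℂ => f (slice I w)) z Complex.I) = 0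

/-- `u` takes values in `[-∞, ∞)` on `s` and is upper semicontinuous there. -/
def UscOn {X : Type*} [TopologicalSpace X] (u : X → EReal) (s : Set X) : Prop :=
  (∀ x ∈ s, u x ≠ ⊤) ∧ UpperSemicontinuousOn u s

/-- The class `us(Ω)`: upper semicontinuous functions `Ω → [-∞, ∞)` that are not identically
`-∞`. -/
def InUs (u : ℍ → EReal) (Ω : Set ℍ) : Prop :=
  UscOn u Ω ∧ ∃ q ∈ Ω, u q ≠ ⊥

/-- Subharmonic functions on an open subset `D` of `ℂ`: upper semicontinuous functions
`D → [-∞, ∞)` that lie below every harmonic function on a relatively compact open subset `G` of `D`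
as soon as they do so on the boundary of `G`.
The value `-∞` is allowed to be taken identically on components of `D`. -/
def SubharmonicOn (v : ℂ → EReal) (D : Set ℂ) : Prop :=
  UscOn v D ∧
  ∀ G : Set ℂ, IsOpen G → IsCompact (closure G) → closure G ⊆ D →
    ∀ h : ℂ → ℝ, InnerProductSpace.HarmonicOnNhd h G → ContinuousOn h (closure G) →
      (∀ z ∈ frontier G, v z ≤ (h z : EReal)) → ∀ z ∈ G, v z ≤ (h z : EReal)

/-- `v` is real-valued on `s`. -/
def FiniteOn {X : Type*} (v : X → EReal) (s : Set X) : Prop := ∀ x ∈ s, v x ≠ ⊥ ∧ v x ≠ ⊤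

/-- Harmonic functions on an open subset `D` of `ℂ`, for functions with values a priori in
`[-∞, ∞)`. -/
def HarmonicOn (v : ℂ → EReal) (D : Set ℂ) : Prop :=
  FiniteOn v D ∧ InnerProductSpace.HarmonicOnNhd (fun z => (v z).toReal) D

/-- `u` is plurisubharmonic on `Ω` for the constant orthogonal complex structure `v ↦ Iv`: it
belongs to `us(Ω)` and is subharmonic (or `-∞`) along every complex line
`λ ↦ a + λb`, `λ ∈ L_I ≃ ℂ`. -/
def PlurisubharmonicOn (I : ℍ) (u : ℍ → EReal) (Ω : Set ℍ) : Prop :=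
  InUs u Ω ∧
  ∀ a ∈ Ω, ∀ b : ℍ,
    SubharmonicOn (fun z => u (a + slice I z * b)) {z : ℂ | a + slice I z * b ∈ Ω}

/-- `u` is pluriharmonic on `Ω` for the constant orthogonal complex structure `v ↦ Iv`: it is
real-valued, of class `C²`, and harmonic along every complex line. -/
def PluriharmonicOn (I : ℍ) (u : ℍ → EReal) (Ω : Set ℍ) : Prop :=
  FiniteOn u Ω ∧ ContDiffOn ℝ 2 (fun q => (u q).toReal) Ω ∧
  ∀ a ∈ Ω, ∀ b : ℍ,
    HarmonicOn (fun z => u (a + slice I z * b)) {z : ℂ | a + slice I z * b ∈ Ω}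

def StronglySubharmonicOn (u : ℍ → EReal) (Ω : Set ℍ) : Prop :=
  ∀ I ∈ imagUnits, PlurisubharmonicOn I u Ω

def StronglyHarmonicOn (u : ℍ → EReal) (Ω : Set ℍ) : Prop :=
  ∀ I ∈ imagUnits, PluriharmonicOn I u Ω

/-- The restriction of `u` to every slice `Ω_I` is subharmonic. -/
def SlicewiseSubharmonicOn (u : ℍ → EReal) (Ω : Set ℍ) : Prop :=
  ∀ I ∈ imagUnits, SubharmonicOn (fun z => u (slice I z)) (sliceSet I Ω)

/-- The restriction of `u` to every slice `Ω_I` is harmonic. -/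
def SlicewiseHarmonicOn (u : ℍ → EReal) (Ω : Set ℍ) : Prop :=
  ∀ I ∈ imagUnits, HarmonicOn (fun z => u (slice I z)) (sliceSet I Ω)

/-- Weakly subharmonic: upper semicontinuous on `Ω`, and subharmonic on every slice. -/
def WeaklySubharmonicOn (u : ℍ → EReal) (Ω : Set ℍ) : Prop :=
  UscOn u Ω ∧ SlicewiseSubharmonicOn u Ω

/-- Weakly harmonic: upper semicontinuous on `Ω`, and harmonic on every slice. -/
def WeaklyHarmonicOn (u : ℍ → EReal) (Ω : Set ℍ) : Prop :=
  UscOn u Ω ∧ SlicewiseHarmonicOn u Ω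

end Quat

namespace Quat

open InnerProductSpace Set Filter Topology Metric MeasureTheory
open scoped RealInnerProductSpace ENNReal

/-! On `L_I` a regular function is a curve holomorphic for the structure `q ↦ I * q`. The forward
implications therefore say that plurisubharmonicity (pluriharmonicity) passes from complex lines to
holomorphic curves. The converses need only the maps `q ↦ a + q * b`, which are regular and restrict
on `L_I` to the complex lines of that structure, for every `I` at once.

Subharmonic case: subharmonicity is traded for an equivalent local condition at each point,
`ViscositySubharmonicOn`. Suppose a test function touches `u ∘ f` from above. In
`viscositySubharmonicOn_comp` the curve is allowed to move by small translations `w`, at a cost `N *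
‖w‖ ^ 2`. At the optimal translation, the deviation of `f` from its tangent line can be absorbed
into `w`; it costs a harmonic term plus a quadratically small error. Hence a complex line violates
the condition too. No smoothing of `u` is required.

Harmonic case: for `u` of class `C²`, the Laplacian of `u ∘ f` at a point is that of `u` along the
tangent line (`PluriharmonicOn.harmonicOn_comp`). In the converse, `C²` regularity must be proved:
`contDiffOn_of_harmonicOn_lines` obtains it from the mean value property over the circles `p -
e^{Iθ} q`, which makes `u` locally a multiple of its convolution with a smooth radial bump.

The weak statements also ask for upper semicontinuity of `u ∘ f`. This follows from the continuity
of `f` on symmetric slice domains, a consequence of the representation formula. -/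

/-! ### Imaginary units -/

lemma mul_self_of_mem {I : ℍ} (hI : I ∈ imagUnits) : I * I = -1 := by
  have : I ^ 2 = -1 := hI
  rwa [pow_two] at this

lemma norm_of_mem {I : ℍ} (hI : I ∈ imagUnits) : ‖I‖ = 1 := by
  have h : ‖I * I‖ = 1 := by rw [mul_self_of_mem hI]; simp
  rw [norm_mul] at h
  nlinarith [norm_nonneg I]

lemma star_of_mem {I : ℍ} (hI : I ∈ imagUnits) : star I = -I := by
  have h1 : I * star I = 1 := by
    rw [Quaternion.self_mul_star, Quaternion.normSq_eq_norm_mul_self, norm_of_mem hI]; simp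
  have h2 : I * (I * star I) = I := by rw [h1, mul_one]
  rw [← mul_assoc, mul_self_of_mem hI] at h2
  rw [neg_one_mul] at h2
  rw [← h2, neg_neg, h2]

lemma neg_mem_imagUnits {I : ℍ} (hI : I ∈ imagUnits) : -I ∈ imagUnits := by
  show (-I) ^ 2 = -1
  rw [neg_sq]; exact hI

/-! ### The slice embeddings -/

lemma slice_add (I : ℍ) (z w : ℂ) : slice I (z + w) = slice I z + slice I w := by
  simp only [slice, Complex.add_re, Complex.add_im, Quaternion.coe_add]
  noncomm_ring

lemma slice_smul (I : ℍ) (c : ℝ) (z : ℂ) : slice I (c • z) = c • slice I z := by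
  simp only [slice, Complex.smul_re, Complex.smul_im, smul_eq_mul, Quaternion.coe_mul, smul_add,
    Quaternion.coe_mul_eq_smul, smul_smul, smul_mul_assoc]

@[simp] lemma slice_zero (I : ℍ) : slice I 0 = 0 := by simp [slice]

@[simp] lemma slice_one (I : ℍ) : slice I 1 = 1 := by simp [slice]

@[simp] lemma slice_I (I : ℍ) : slice I Complex.I = I := by simp [slice]

lemma slice_ofReal (I : ℍ) (x : ℝ) : slice I x = x := by simp [slice]

lemma slice_neg_conj (I : ℍ) (z : ℂ) : slice (-I) (starRingEnd ℂ z) = slice I z := by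
  simp [slice]

/-- The slice embedding as a continuous linear map. -/
noncomputable def sliceCLM (I : ℍ) : ℂ →L[ℝ] ℍ :=
  LinearMap.toContinuousLinearMap
    { toFun := slice I, map_add' := slice_add I, map_smul' := slice_smul I }

@[simp] lemma sliceCLM_apply (I : ℍ) (z : ℂ) : sliceCLM I z = slice I z := rfl

lemma continuous_slice (I : ℍ) : Continuous (slice I) := (sliceCLM I).continuous

lemma slice_mul {I : ℍ} (hI : I ∈ imagUnits) (z w : ℂ) :
    slice I (z * w) = slice I z * slice I w := by
  have h (a b : ℝ) : (a : ℍ) * I * ((b : ℍ) * I) = -((a * b : ℝ) : ℍ) := by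
    rw [mul_assoc, ← mul_assoc I, ← (Quaternion.coe_commutes b I), mul_assoc (b : ℍ),
      mul_self_of_mem hI]
    simp
  simp only [slice, Complex.mul_re, Complex.mul_im, add_mul, mul_add, h]
  rw [mul_assoc _ I, ← Quaternion.coe_commutes w.re I]
  simp only [Quaternion.coe_add, Quaternion.coe_sub, Quaternion.coe_mul]
  noncomm_ring

lemma norm_slice {I : ℍ} (hI : I ∈ imagUnits) (z : ℂ) : ‖slice I z‖ = ‖z‖ := by
  have h : slice I z * star (slice I z) = ((‖z‖ ^ 2 : ℝ) : ℍ) := by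
    have h1 : star (slice I z) = slice I (starRingEnd ℂ z) := by
      simp [slice, star_of_mem hI, Quaternion.coe_commutes]
    rw [h1, ← slice_mul hI, Complex.mul_conj, slice_ofReal, Complex.normSq_eq_norm_sq]
  rw [Quaternion.self_mul_star, Quaternion.normSq_eq_norm_mul_self] at h
  have h2 := Quaternion.coe_injective h
  nlinarith [norm_nonneg z, norm_nonneg (slice I z)]

lemma isOpen_sliceSet (I : ℍ) {Ω : Set ℍ} (h : IsOpen Ω) : IsOpen (sliceSet I Ω) :=
  h.preimage (continuous_slice I)

/-! ### Maps that are holomorphic for the complex structure `q ↦ I * q` -/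

/-- Real differentiability together with the Cauchy–Riemann equation for the complex structure
`q ↦ I * q`. -/
def SliceHolomorphicOn (I : ℍ) (f : ℂ → ℍ) (D : Set ℂ) : Prop :=
  ∀ z ∈ D, DifferentiableAt ℝ f z ∧ fderiv ℝ f z Complex.I = I * fderiv ℝ f z 1

lemma RegularOn.sliceHolomorphicOn {f : ℍ → ℍ} {Ω : Set ℍ} (hΩ : IsOpen Ω) (hf : RegularOn f Ω)
    {I : ℍ} (hI : I ∈ imagUnits) :
    SliceHolomorphicOn I (fun z => f (slice I z)) (sliceSet I Ω) := by
  intro z hz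
  obtain ⟨h1, h2⟩ := hf I hI
  refine ⟨(h1.contDiffAt ((isOpen_sliceSet I hΩ).mem_nhds hz)).differentiableAt (by simp), ?_⟩
  have h3 := (smul_eq_zero.1 (h2 z hz)).resolve_left (by norm_num)
  rw [eq_neg_of_add_eq_zero_left h3, mul_neg, ← mul_assoc, mul_self_of_mem hI]
  simp

lemma SliceHolomorphicOn.continuousOn {I : ℍ} {f : ℂ → ℍ} {D : Set ℂ}
    (hf : SliceHolomorphicOn I f D) : ContinuousOn f D :=
  fun z hz => (hf z hz).1.continuousAt.continuousWithinAt

lemma SliceHolomorphicOn.fderiv_apply {I : ℍ} {f : ℂ → ℍ} {D : Set ℂ}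
    (hf : SliceHolomorphicOn I f D) {z : ℂ} (hz : z ∈ D) (w : ℂ) :
    fderiv ℝ f z w = slice I w * fderiv ℝ f z 1 := by
  have h : w = w.re • (1 : ℂ) + w.im • Complex.I := by
    simp
  conv_lhs => rw [h]
  rw [map_add, map_smul, map_smul, (hf z hz).2, slice, add_mul, mul_assoc,
    Quaternion.coe_mul_eq_smul, Quaternion.coe_mul_eq_smul]

/-- The complex linear functional (for the structure `q ↦ I * q`) with real part `⟪w, ·⟫`. -/
noncomputable def lineFunctional (I w : ℍ) : ℍ →L[ℝ] ℂ :=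
  Complex.ofRealCLM ∘L innerSL ℝ w -
    Complex.I • (Complex.ofRealCLM ∘L innerSL ℝ w ∘L ContinuousLinearMap.mul ℝ ℍ I)

lemma lineFunctional_apply (I w q : ℍ) :
    lineFunctional I w q = (⟪w, q⟫ : ℂ) - Complex.I * (⟪w, I * q⟫ : ℂ) := by
  simp [lineFunctional]

lemma re_lineFunctional (I w q : ℍ) : (lineFunctional I w q).re = ⟪w, q⟫ := by
  simp [lineFunctional_apply]

lemma lineFunctional_unit_mul {I : ℍ} (hI : I ∈ imagUnits) (w q : ℍ) :
    lineFunctional I w (I * q) = Complex.I * lineFunctional I w q := by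
  rw [lineFunctional_apply, lineFunctional_apply, ← mul_assoc, mul_self_of_mem hI, mul_sub,
    ← mul_assoc, Complex.I_mul_I]
  simp
  ring

/-- The functional is complex linear from `(ℍ, q ↦ I * q)` to `ℂ`, so the scalar Cauchy–Riemann
equation is inherited. Scalar complex analysis thus applies to all real coordinates `⟪w, f⟫` of a
holomorphic curve. -/
lemma SliceHolomorphicOn.differentiableOn_lineFunctional {I : ℍ} (hI : I ∈ imagUnits) {f : ℂ → ℍ}
    {D : Set ℂ} (hf : SliceHolomorphicOn I f D) (w : ℍ) :
    DifferentiableOn ℂ (fun z => lineFunctional I w (f z)) D := by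
  intro z hz
  obtain ⟨h1, h2⟩ := hf z hz
  have h3 : HasFDerivAt (fun z => lineFunctional I w (f z))
      (lineFunctional I w ∘L fderiv ℝ f z) z :=
    (lineFunctional I w).hasFDerivAt.comp z h1.hasFDerivAt
  refine DifferentiableAt.differentiableWithinAt ?_
  rw [differentiableAt_complex_iff_differentiableAt_real]
  refine ⟨h3.differentiableAt, ?_⟩
  rw [h3.fderiv]
  simp [h2, lineFunctional_unit_mul hI]

lemma SliceHolomorphicOn.harmonicAt_inner {I : ℍ} (hI : I ∈ imagUnits) {f : ℂ → ℍ}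
    {D : Set ℂ} (hD : IsOpen D) (hf : SliceHolomorphicOn I f D) {z : ℂ} (hz : z ∈ D) (w : ℍ) :
    HarmonicAt (fun z => ⟪w, f z⟫) z := by
  have h := (hf.differentiableOn_lineFunctional hI w).analyticAt (hD.mem_nhds hz)
  have h' := h.harmonicAt_re
  simpa only [re_lineFunctional] using h'

lemma SliceHolomorphicOn.contDiffAt {I : ℍ} (hI : I ∈ imagUnits) {f : ℂ → ℍ}
    {D : Set ℂ} (hD : IsOpen D) (hf : SliceHolomorphicOn I f D) {z : ℂ} (hz : z ∈ D) :
    ContDiffAt ℝ 2 f z := by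
  have h : f = fun z => ∑ i, ⟪stdOrthonormalBasis ℝ ℍ i, f z⟫ • stdOrthonormalBasis ℝ ℍ i := by
    ext1 z
    exact ((stdOrthonormalBasis ℝ ℍ).sum_repr' (f z)).symm
  rw [h]
  exact ContDiffAt.sum fun i _ => (hf.harmonicAt_inner hI hD hz _).1.smul contDiffAt_const

lemma SliceHolomorphicOn.laplacian_eq_zero {I : ℍ} (hI : I ∈ imagUnits) {f : ℂ → ℍ}
    {D : Set ℂ} (hD : IsOpen D) (hf : SliceHolomorphicOn I f D) {z : ℂ} (hz : z ∈ D) :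
    Laplacian.laplacian f z = 0 := by
  refine ext_inner_left ℝ fun w => ?_
  have h := (hf.harmonicAt_inner hI hD hz w).2.self_of_nhds
  have h2 := (hf.contDiffAt hI hD hz).laplacian_CLM_comp_left (l := innerSL ℝ w)
  have h3 : (innerSL ℝ w ∘ f) = fun z => ⟪w, f z⟫ := by ext; simp
  rw [h3, h] at h2
  simpa using h2.symm

/-- Identity principle on a connected open set that meets the real axis. -/
lemma SliceHolomorphicOn.eqOn {I : ℍ} (hI : I ∈ imagUnits) {f g : ℂ → ℍ} {D : Set ℂ}
    (hD : IsOpen D) (hc : IsPreconnected D) (hf : SliceHolomorphicOn I f D)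
    (hg : SliceHolomorphicOn I g D) {x : ℝ} (hx : (x : ℂ) ∈ D)
    (hfg : ∀ y : ℝ, (y : ℂ) ∈ D → f y = g y) : EqOn f g D := by
  intro z hz
  refine ext_inner_left ℝ fun w => ?_
  rw [← re_lineFunctional I, ← re_lineFunctional I]
  congr 1
  refine AnalyticOnNhd.eqOn_of_preconnected_of_frequently_eq
    ((hf.differentiableOn_lineFunctional hI w).analyticOnNhd hD)
    ((hg.differentiableOn_lineFunctional hI w).analyticOnNhd hD) hc hx ?_ hz
  -- The real points of `D` accumulate at `x`, which is all the scalar identity theorem needs.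
  have h1 : Tendsto (fun y : ℝ => (y : ℂ)) (𝓝[≠] x) (𝓝[≠] (x : ℂ)) :=
    tendsto_nhdsWithin_of_tendsto_nhds_of_eventually_within _
      (Complex.continuous_ofReal.continuousAt.mono_left nhdsWithin_le_nhds)
      (by filter_upwards [self_mem_nhdsWithin] with y hy; simpa using hy)
  have h2 : ∀ᶠ y : ℝ in 𝓝[≠] x, (y : ℂ) ∈ D :=
    nhdsWithin_le_nhds (Complex.continuous_ofReal.continuousAt (hD.mem_nhds hx))
  exact h1.frequently (h2.mono fun y hy => by rw [hfg y hy]).frequently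

/-! ### Harmonic functions: affine changes of variable -/

lemma harmonicAt_clm {F : Type*} [NormedAddCommGroup F] [NormedSpace ℝ F] (l : ℂ →L[ℝ] F) (z : ℂ) :
    HarmonicAt (fun w => l w) z :=
  (analyticAt_id (𝕜 := ℂ) (z := z)).harmonicAt.comp_CLM l

lemma _root_.InnerProductSpace.HarmonicAt.comp_add_left {E F : Type*} [NormedAddCommGroup E]
    [InnerProductSpace ℝ E] [FiniteDimensional ℝ E] [NormedAddCommGroup F] [NormedSpace ℝ F]
    {f : E → F} {a z : E} (hf : HarmonicAt f (a + z)) : HarmonicAt (fun w => f (a + w)) z := by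
  have hc : ContinuousAt (fun w => a + w) z := by fun_prop
  refine ⟨hf.1.comp z (by fun_prop), ?_⟩
  have h : Laplacian.laplacian (fun w => f (a + w)) = fun w => Laplacian.laplacian f (a + w) := by
    simp [laplacian_eq_iteratedFDeriv_stdOrthonormalBasis, iteratedFDeriv_comp_add_left]
  rw [h]
  exact hc.eventually hf.2

/-! ### Upper semicontinuous functions with values in `[-∞, ∞)` -/

lemma UscOn.comp {X Y : Type*} [TopologicalSpace X] [TopologicalSpace Y] {u : X → EReal} {s : Set X}
    (hu : UscOn u s) {g : Y → X} {t : Set Y} (hg : ContinuousOn g t) (hst : MapsTo g t s) :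
    UscOn (fun y => u (g y)) t :=
  ⟨fun _ hy => hu.1 _ (hst hy), hu.2.comp hg hst⟩

lemma UscOn.mono {X : Type*} [TopologicalSpace X] {u : X → EReal} {s t : Set X} (hu : UscOn u s)
    (h : t ⊆ s) : UscOn u t :=
  ⟨fun _ hy => hu.1 _ (h hy), hu.2.mono h⟩

/-- A function in `[-∞, ∞)` plus a continuous real function attains its maximum on a compact set. -/
lemma UscOn.exists_isMax_add {X : Type*} [TopologicalSpace X] {v : X → EReal} {K : Set X}
    (hv : UscOn v K) (hK : IsCompact K) {c : X → ℝ} (hc : ContinuousOn c K) {x₁ : X}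
    (hx₁ : x₁ ∈ K) (hfin : v x₁ ≠ ⊥) :
    ∃ x ∈ K, ∃ M : ℝ, v x = ((M - c x : ℝ) : EReal) ∧
      ∀ y ∈ K, v y ≤ ((M - c y : ℝ) : EReal) := by
  have hc' : UpperSemicontinuousOn (fun x => (c x : EReal)) K :=
    (continuous_coe_real_ereal.comp_continuousOn hc).upperSemicontinuousOn
  have h := hv.2.add' hc' fun x hx => EReal.continuousAt_add (by simp) (by simp)
  obtain ⟨x, hx, hmax⟩ := h.exists_isMaxOn ⟨x₁, hx₁⟩ hK
  have hmax' : ∀ y ∈ K, v y + (c y : EReal) ≤ v x + c x := fun y hy => hmax hy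
  have hxb : v x ≠ ⊥ := by
    intro hb
    have := hmax' x₁ hx₁
    rw [hb, EReal.bot_add, le_bot_iff, EReal.add_eq_bot_iff] at this
    simp [hfin] at this
  lift v x to ℝ using ⟨hv.1 x hx, hxb⟩ with a ha
  refine ⟨x, hx, a + c x, by rw [← ha]; simp, fun y hy => ?_⟩
  have h1 := hmax' y hy
  rw [← EReal.coe_add] at h1
  rw [EReal.coe_sub]
  exact EReal.le_sub_iff_add_le (by simp) (by simp) |>.2 h1

/-! ### A local form of subharmonicity -/

/-- No harmonic function minus a positive multiple of `‖z - z₀‖ ^ 2` touches `v` from above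
at a point `z₀` of `D`. -/
def ViscositySubharmonicOn (v : ℂ → EReal) (D : Set ℂ) : Prop :=
  ∀ z₀ ∈ D, ∀ h : ℂ → ℝ, HarmonicAt h 0 → ∀ k : ℝ, 0 < k → v z₀ = (h 0 : EReal) →
    ¬ ∀ᶠ w in 𝓝 (0 : ℂ), v (z₀ + w) ≤ ((h w - k * ‖w‖ ^ 2 : ℝ) : EReal)

/-- If such an `h` existed, `v` would lie below the harmonic function `h - k * r ^ 2` on a small
circle of radius `r`, hence also at the centre, where `v` equals `h`. -/
lemma SubharmonicOn.viscositySubharmonicOn {v : ℂ → EReal} {D : Set ℂ} (hD : IsOpen D)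
    (hv : SubharmonicOn v D) : ViscositySubharmonicOn v D := by
  intro z₀ hz₀ h hh k hk heq hev
  have hDz : ∀ᶠ w in 𝓝 (0 : ℂ), z₀ + w ∈ D :=
    (by fun_prop : ContinuousAt (fun w : ℂ => z₀ + w) 0) (hD.mem_nhds (by simpa using hz₀))
  obtain ⟨r, hr, hball⟩ := nhds_basis_closedBall.eventually_iff.1 (hDz.and (hh.eventually.and hev))
  have hsub {z : ℂ} (hz : z ∈ closedBall z₀ r) : -z₀ + z ∈ closedBall (0 : ℂ) r := by
    rw [mem_closedBall_iff_norm] at hz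
    simpa [neg_add_eq_sub] using hz
  have hcl : closure (ball z₀ r) = closedBall z₀ r := closure_ball z₀ hr.ne'
  have hharm {z : ℂ} (hz : z ∈ closedBall z₀ r) :
      HarmonicAt (fun w => h (-z₀ + w) - k * r ^ 2) z :=
    (hball (hsub hz)).2.1.comp_add_left.sub (harmonicAt_const _)
  have key := hv.2 (ball z₀ r) isOpen_ball (hcl ▸ isCompact_closedBall z₀ r)
    (hcl ▸ fun z hz => by simpa using (hball (hsub hz)).1)
    (fun w => h (-z₀ + w) - k * r ^ 2) (fun z hz => hharm (ball_subset_closedBall hz))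
    (hcl ▸ fun z hz => (hharm hz).1.continuousAt.continuousWithinAt) ?_ z₀ (mem_ball_self hr)
  · rw [heq, EReal.coe_le_coe_iff] at key
    simp only [neg_add_cancel] at key
    nlinarith [mul_pos hk (pow_pos hr 2)]
  · intro z hz
    rw [frontier_ball z₀ hr.ne'] at hz
    have h1 := (hball (hsub (sphere_subset_closedBall hz))).2.2
    rw [mem_sphere_iff_norm, ← neg_add_eq_sub] at hz
    simpa [hz] using h1

/-- If `v` exceeds `h` somewhere in `G`, then `v - h + ε * ‖z‖ ^ 2` still has an interior maximum
for small `ε`. There `v` is touched from above by a harmonic function minus `ε * ‖w‖ ^ 2`. -/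
lemma ViscositySubharmonicOn.subharmonicOn {v : ℂ → EReal} {D : Set ℂ} (husc : UscOn v D)
    (hv : ViscositySubharmonicOn v D) : SubharmonicOn v D := by
  refine ⟨husc, fun G hG hGc hGD h hh hhc hle z₁ hz₁ => ?_⟩
  by_contra! hlt
  have hz₁' := subset_closure hz₁
  have hfin : v z₁ ≠ ⊥ := ne_bot_of_gt hlt
  obtain ⟨a, ha⟩ : ∃ a : ℝ, v z₁ = a :=
    ⟨(v z₁).toReal, (EReal.coe_toReal (husc.1 _ (hGD hz₁')) hfin).symm⟩
  rw [ha, EReal.coe_lt_coe_iff] at hlt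
  obtain ⟨R, hR⟩ := hGc.isBounded.exists_norm_le
  -- With this choice `ε * R ^ 2` is less than the gap `a - h z₁`, so the perturbed maximum cannot
  -- sit on the frontier.
  set ε := (a - h z₁) / (2 * (R ^ 2 + 1)) with hε
  have hR1 : 0 < R ^ 2 + 1 := by positivity
  have hεpos : 0 < ε := div_pos (by linarith) (by positivity)
  have hεeq : ε * (R ^ 2 + 1) * 2 = a - h z₁ := by rw [hε]; field_simp
  obtain ⟨z₀, hz₀, M, hM, hmax⟩ := (husc.mono hGD).exists_isMax_add hGc
    (c := fun z => -h z + ε * ‖z‖ ^ 2) (hhc.neg.add (by fun_prop)) hz₁' hfin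
  have hMa := hmax z₁ hz₁'
  rw [ha, EReal.coe_le_coe_iff] at hMa
  have hz₀G : z₀ ∈ G := by
    by_contra hnot
    have h1 := hle z₀ ⟨hz₀, by rwa [hG.interior_eq]⟩
    rw [hM, EReal.coe_le_coe_iff] at h1
    have h2 : ε * ‖z₀‖ ^ 2 ≤ ε * R ^ 2 := by
      gcongr
      exact hR _ hz₀
    nlinarith [mul_nonneg hεpos.le (sq_nonneg ‖z₁‖)]
  -- Expanding `ε * ‖z₀ + w‖ ^ 2` leaves a constant and a linear term, both harmonic, and the strict
  -- term `ε * ‖w‖ ^ 2`.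
  refine hv z₀ (hGD hz₀)
    (fun w => h (z₀ + w) + (M - ε * ‖z₀‖ ^ 2) - (2 * ε) • innerSL ℝ z₀ w) ?_ ε hεpos ?_ ?_
  · have h0 : HarmonicAt h (z₀ + 0) := by simpa using hh z₀ hz₀G
    exact (h0.comp_add_left.add (harmonicAt_const _)).sub (harmonicAt_clm _ _).const_smul
  · rw [hM]
    congr 1
    simp
    ring
  · have hmem : ∀ᶠ w in 𝓝 (0 : ℂ), z₀ + w ∈ G :=
      (by fun_prop : ContinuousAt (fun w : ℂ => z₀ + w) 0) (hG.mem_nhds (by simpa using hz₀G))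
    filter_upwards [hmem] with w hw
    refine (hmax _ (subset_closure hw)).trans (EReal.coe_le_coe_iff.2 (le_of_eq ?_))
    rw [norm_add_sq_real]
    simp
    ring

/-! ### Composition with holomorphic curves -/

/-- An upper semicontinuous function that is subharmonic along all complex lines for the structure
`q ↦ I * q` is subharmonic along all holomorphic curves for that structure. -/
theorem viscositySubharmonicOn_comp {I : ℍ} (hI : I ∈ imagUnits) {u : ℍ → EReal} {Ω : Set ℍ}
    (hΩ : IsOpen Ω) (hu : UscOn u Ω)
    (hline : ∀ a ∈ Ω, ∀ b : ℍ,
      ViscositySubharmonicOn (fun z => u (a + slice I z * b)) {z : ℂ | a + slice I z * b ∈ Ω})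
    {f : ℂ → ℍ} {D : Set ℂ} (hD : IsOpen D) (hf : SliceHolomorphicOn I f D) (hmaps : MapsTo f D Ω) :
    ViscositySubharmonicOn (fun z => u (f z)) D := by
  intro z₀ hz₀ h hh k hk heq hev
  have hDz : ∀ᶠ w in 𝓝 (0 : ℂ), z₀ + w ∈ D :=
    (by fun_prop : ContinuousAt (fun w : ℂ => z₀ + w) 0) (hD.mem_nhds (by simpa using hz₀))
  obtain ⟨r, hr, hball⟩ := nhds_basis_closedBall.eventually_iff.1 (hDz.and (hh.eventually.and hev))
  -- The curve together with its small translates.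
  set F : ℍ × ℂ → ℍ := fun p => f (z₀ + p.2) + p.1 with hF
  have hFc (y : ℂ) (hy : y ∈ closedBall (0 : ℂ) r) (w : ℍ) : ContinuousAt F (w, y) := by
    have h1 : ContinuousAt (fun p : ℍ × ℂ => f (z₀ + p.2)) (w, y) :=
      ContinuousAt.comp (g := f) (f := fun p : ℍ × ℂ => z₀ + p.2) (hf _ (hball hy).1).1.continuousAt
        (by fun_prop)
    exact h1.add continuousAt_fst
  have hF0 (y : ℂ) (hy : y ∈ closedBall (0 : ℂ) r) : F (0, y) ∈ Ω := by
    simpa [hF] using hmaps (hball hy).1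
  have htube : ∀ᶠ w in 𝓝 (0 : ℍ), ∀ y ∈ closedBall (0 : ℂ) r, F (w, y) ∈ Ω :=
    (isCompact_closedBall 0 r).eventually_forall_of_forall_eventually
      (P := fun w y => F (w, y) ∈ Ω) fun y hy => (hFc y hy 0) (hΩ.mem_nhds (hF0 y hy))
  -- On the circle the margin is `k * r ^ 2` for `w = 0`. Half of it survives small translations: a
  -- quarter pays for strictness and a quarter for the variation of `h`.
  have hside : ∀ᶠ w in 𝓝 (0 : ℍ), ∀ y ∈ sphere (0 : ℂ) r,
      u (F (w, y)) < ((h y - k / 2 * r ^ 2 : ℝ) : EReal) := by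
    refine (isCompact_sphere 0 r).eventually_forall_of_forall_eventually
      (P := fun w y => u (F (w, y)) < ((h y - k / 2 * r ^ 2 : ℝ) : EReal)) fun y hy => ?_
    have hy' := sphere_subset_closedBall hy
    have hkr : 0 < k * r ^ 2 := by positivity
    have hlt : u (F (0, y)) < ((h y - 3 / 4 * (k * r ^ 2) : ℝ) : EReal) := by
      have h1 := (hball hy').2.2
      rw [mem_sphere_zero_iff_norm.1 hy] at h1
      simp only [hF, add_zero]
      refine h1.trans_lt (EReal.coe_lt_coe_iff.2 ?_)
      linarith
    have h2 : ∀ᶠ q in 𝓝 (F (0, y)), u q < ((h y - 3 / 4 * (k * r ^ 2) : ℝ) : EReal) := by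
      have := hu.2 _ (hF0 y hy') _ hlt
      rwa [hΩ.nhdsWithin_eq (hF0 y hy')] at this
    have h3 : ContinuousAt (fun p : ℍ × ℂ => h p.2) ((0 : ℍ), y) :=
      ContinuousAt.comp (g := h) (f := fun p : ℍ × ℂ => p.2) (hball hy').2.1.1.continuousAt
        continuousAt_snd
    filter_upwards [(hFc y hy' 0).eventually h2,
      h3.eventually_const_lt (u := h y - 1 / 4 * (k * r ^ 2)) (by simp only; linarith)] with p hp1 hp2
    refine hp1.trans (EReal.coe_lt_coe_iff.2 ?_)
    linarith
  obtain ⟨ρ, hρ, hρball⟩ := nhds_basis_closedBall.eventually_iff.1 (htube.and hside)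
  set K : Set (ℍ × ℂ) := closedBall 0 ρ ×ˢ closedBall 0 r with hK
  have hKc : IsCompact K := (isCompact_closedBall 0 ρ).prod (isCompact_closedBall 0 r)
  have huK : UscOn (fun p => u (F p)) K :=
    hu.comp (fun p hp => (hFc p.2 hp.2 p.1).continuousWithinAt) fun p hp => (hρball hp.1).1 _ hp.2
  have h0K : ((0 : ℍ), (0 : ℂ)) ∈ K := ⟨mem_closedBall_self hρ.le, mem_closedBall_self hr.le⟩
  have hu0 : u (F (0, 0)) = (h 0 : EReal) := by simpa [hF] using heq
  have hfin : u (F (0, 0)) ≠ ⊥ := by rw [hu0]; simp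
  have hhc : ContinuousOn (fun p : ℍ × ℂ => h p.2) K := fun p hp =>
    (ContinuousAt.comp (g := h) (f := fun p : ℍ × ℂ => p.2) (hball hp.2).2.1.1.continuousAt
        continuousAt_snd).continuousWithinAt
  obtain ⟨-, -, M₀, -, hM₀⟩ := huK.exists_isMax_add hKc
    (c := fun p => -h p.2 + k / 2 * ‖p.2‖ ^ 2) (hhc.neg.add (by fun_prop)) h0K hfin
  -- `M₀` is the maximum without penalty, so at `‖w‖ = ρ` the penalized value is at most `M₀ - |M₀|
  -- - 1 < 0`. The value at `(0, 0)` is `0`, so the maximizer has `‖w₁‖ < ρ`.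
  set N := (|M₀| + 1) / ρ ^ 2 with hN
  have hNpos : 0 < N := by positivity
  have hNρ : N * ρ ^ 2 = |M₀| + 1 := by rw [hN]; field_simp
  obtain ⟨⟨w₁, y₁⟩, hmem, M, hM, hmax⟩ := huK.exists_isMax_add hKc
    (c := fun p => -h p.2 + k / 2 * ‖p.2‖ ^ 2 - N * ‖p.1‖ ^ 2)
    ((hhc.neg.add (by fun_prop)).sub (by fun_prop)) h0K hfin
  simp only at hM
  have hM0 : 0 ≤ M := by
    have := hmax _ h0K
    simp only [hu0, EReal.coe_le_coe_iff] at this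
    simpa using this
  have hw₁ : w₁ ∈ ball (0 : ℍ) ρ := by
    refine mem_ball_zero_iff.2 ((mem_closedBall_zero_iff.1 hmem.1).lt_of_ne fun hw => ?_)
    have := hM₀ _ hmem
    simp only [hM, EReal.coe_le_coe_iff, hw] at this
    linarith [le_abs_self M₀]
  have hy₁ : y₁ ∈ ball (0 : ℂ) r := by
    refine mem_ball_zero_iff.2 ((mem_closedBall_zero_iff.1 hmem.2).lt_of_ne fun hy => ?_)
    have := (hρball hmem.1).2 y₁ (mem_sphere_zero_iff_norm.2 hy)
    simp only [hM, EReal.coe_lt_coe_iff, hy] at this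
    nlinarith [mul_nonneg hNpos.le (sq_nonneg ‖w₁‖)]
  have hpΩ : F (w₁, y₁) ∈ Ω := (hρball hmem.1).1 _ hmem.2
  have hzD : z₀ + y₁ ∈ D := (hball hmem.2).1
  set b := fderiv ℝ f (z₀ + y₁) 1 with hb
  -- Translating by `w₁ - rem μ` straightens the curve: `F (w₁ - rem μ, y₁ + μ)` runs along a
  -- complex line through `F (w₁, y₁)`.
  set rem : ℂ → ℍ := fun μ => f (z₀ + y₁ + μ) - f (z₀ + y₁) - slice I μ * b with hrem
  have hlittle : ∀ᶠ μ in 𝓝 (0 : ℂ), N * ‖rem μ‖ ^ 2 ≤ k / 4 * ‖μ‖ ^ 2 := by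
    have h1 := hasFDerivAt_iff_isLittleO_nhds_zero.1 (hf _ hzD).1.hasFDerivAt
    have hc : 0 < Real.sqrt (k / 4 / N) := Real.sqrt_pos.2 (by positivity)
    filter_upwards [h1.def hc] with μ hμ
    rw [hf.fderiv_apply hzD] at hμ
    calc N * ‖rem μ‖ ^ 2 ≤ N * (Real.sqrt (k / 4 / N) * ‖μ‖) ^ 2 := by gcongr
      _ = k / 4 * ‖μ‖ ^ 2 := by
        rw [mul_pow, Real.sq_sqrt (by positivity)]
        field_simp
  have hrem_tendsto : ContinuousAt rem 0 := by
    have h1 : ContinuousAt (fun μ : ℂ => f (z₀ + y₁ + μ)) 0 :=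
      ContinuousAt.comp (g := f) (by simpa using (hf _ hzD).1.continuousAt) (by fun_prop)
    have h2 := (continuous_slice I).continuousAt (x := 0)
    exact (h1.sub continuousAt_const).sub (h2.mul continuousAt_const)
  have hrem0 : rem 0 = 0 := by simp [hrem]
  have hnear : ∀ᶠ μ in 𝓝 (0 : ℂ), (w₁ - rem μ, y₁ + μ) ∈ K := by
    have h1 : ContinuousAt (fun μ => (w₁ - rem μ, y₁ + μ)) (0 : ℂ) :=
      (continuousAt_const.sub hrem_tendsto).prodMk (by fun_prop)
    refine h1 (mem_of_superset ?_ (prod_mono ball_subset_closedBall ball_subset_closedBall))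
    refine (isOpen_ball.prod isOpen_ball).mem_nhds ?_
    simpa [hrem0] using And.intro hw₁ hy₁
  have hremharm : HarmonicAt (fun μ => ⟪w₁, rem μ⟫) 0 := by
    have h1 : HarmonicAt (fun z => ⟪w₁, f z⟫) (z₀ + y₁ + 0) := by
      simpa using hf.harmonicAt_inner hI hD hzD w₁
    have h2 := (h1.comp_add_left.sub (harmonicAt_const ⟪w₁, f (z₀ + y₁)⟫)).sub
      (harmonicAt_clm (innerSL ℝ w₁ ∘L (ContinuousLinearMap.mul ℝ ℍ).flip b ∘L sliceCLM I) 0)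
    convert h2 using 1
    ext μ
    simp [hrem, inner_sub_right]
  -- In `N * ‖w₁ - rem μ‖ ^ 2` the cross term is harmonic because `rem` is holomorphic, and `N *
  -- ‖rem μ‖ ^ 2` uses up only half of the available `k / 2 * ‖μ‖ ^ 2`.
  have hharm : HarmonicAt (fun μ => h (y₁ + μ) + (M - k / 2 * ‖y₁‖ ^ 2 + N * ‖w₁‖ ^ 2)
      - k • innerSL ℝ y₁ μ - (2 * N) • ⟪w₁, rem μ⟫) 0 := by
    have h1 : HarmonicAt h (y₁ + 0) := by simpa using (hball hmem.2).2.1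
    exact ((h1.comp_add_left.add (harmonicAt_const _)).sub (harmonicAt_clm _ _).const_smul).sub
      hremharm.const_smul
  refine hline (F (w₁, y₁)) hpΩ b 0 (by simpa using hpΩ) _ hharm (k / 4) (by positivity) ?_ ?_
  · simp only [slice_zero, zero_mul, add_zero, hM, hrem0, map_zero, smul_zero, inner_zero_right]
    congr 1
    ring
  · filter_upwards [hnear, hlittle] with μ hμ hμ'
    have h1 := hmax _ hμ
    have h2 : F (w₁ - rem μ, y₁ + μ) = F (w₁, y₁) + slice I (0 + μ) * b := by
      simp only [hF, hrem, zero_add, ← add_assoc]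
      abel
    simp only [h2] at h1
    refine h1.trans (EReal.coe_le_coe_iff.2 ?_)
    rw [norm_add_sq_real, norm_sub_sq_real]
    simp only [innerSL_apply_apply, smul_eq_mul]
    linarith

/-! ### Regular functions -/

/-- Right multiplication by `b` commutes with left multiplication by every `I`. These are the test
maps in both converses. -/
lemma regularOn_affine (a b : ℍ) (Ω : Set ℍ) : RegularOn (fun q => a + q * b) Ω := by
  intro I hI
  have h (z : ℂ) : HasFDerivAt (fun z => a + slice I z * b)
      ((ContinuousLinearMap.mul ℝ ℍ).flip b ∘L sliceCLM I) z :=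
    (((ContinuousLinearMap.mul ℝ ℍ).flip b ∘L sliceCLM I).hasFDerivAt).const_add a
  refine ⟨?_, fun z _ => ?_⟩
  · exact (contDiff_const.add
      ((ContinuousLinearMap.mul ℝ ℍ).flip b ∘L sliceCLM I).contDiff).contDiffOn
  · rw [(h z).fderiv]
    simp [← mul_assoc, mul_self_of_mem hI]

lemma exists_mem_imagUnits : ∃ I : ℍ, I ∈ imagUnits := by
  refine ⟨Quaternion.ofComplex Complex.I, ?_⟩
  show Quaternion.ofComplex Complex.I ^ 2 = -1
  rw [← map_pow, Complex.I_sq, map_neg, map_one]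

lemma isSymmetricSliceDomain_ball {r : ℝ} (hr : 0 < r) :
    IsSymmetricSliceDomain (ball (0 : ℍ) r) where
  isOpenDomain := ⟨isOpen_ball, ⟨0, mem_ball_self hr⟩, (convex_ball 0 r).isPreconnected⟩
  meets_real := ⟨0, by simpa using hr⟩
  connected_slice := by
    intro I hI
    have h : sliceSet I (ball (0 : ℍ) r) = ball (0 : ℂ) r := by
      ext z
      simp [sliceSet, norm_slice hI]
    rw [h]
    exact ⟨⟨0, mem_ball_self hr⟩, (convex_ball 0 r).isPreconnected⟩
  symmetric := by
    intro I hI J hJ z hz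
    simpa [norm_slice hI, norm_slice hJ] using hz

lemma conj_mem_sliceSet {Ω : Set ℍ} (hΩ : IsSymmetricSliceDomain Ω) {I : ℍ} (hI : I ∈ imagUnits)
    {z : ℂ} (hz : z ∈ sliceSet I Ω) : starRingEnd ℂ z ∈ sliceSet I Ω := by
  have h := hΩ.symmetric I hI (-I) (neg_mem_imagUnits hI) z hz
  have h2 := slice_neg_conj I (starRingEnd ℂ z)
  rw [Complex.conj_conj] at h2
  show slice I _ ∈ Ω
  rwa [← h2]

/-- The representation formula for regular functions on symmetric slice domains. -/
theorem RegularOn.representation {f : ℍ → ℍ} {Ω : Set ℍ} (hΩ : IsSymmetricSliceDomain Ω)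
    (hf : RegularOn f Ω) {I J : ℍ} (hI : I ∈ imagUnits) (hJ : J ∈ imagUnits) {z : ℂ}
    (hz : slice J z ∈ Ω) :
    f (slice J z) = (1 / 2 : ℝ) • (f (slice I z) + f (slice I (starRingEnd ℂ z))) +
      J * ((1 / 2 : ℝ) • (I * (f (slice I (starRingEnd ℂ z)) - f (slice I z)))) := by
  have hopen := hΩ.isOpenDomain.1
  have hsets : sliceSet J Ω = sliceSet I Ω :=
    Subset.antisymm (fun w hw => hΩ.symmetric J hJ I hI w hw)
      fun w hw => hΩ.symmetric I hI J hJ w hw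
  obtain ⟨x, hx⟩ := hΩ.meets_real
  have hII (q : ℍ) : I * (I * q) = -q := by rw [← mul_assoc, mul_self_of_mem hI, neg_one_mul]
  have hJJ (q : ℍ) : J * (J * q) = -q := by rw [← mul_assoc, mul_self_of_mem hJ, neg_one_mul]
  have hfI := hf.sliceHolomorphicOn hopen hI
  -- The right-hand side, as a function of `z`, is holomorphic for `J` and reduces to `f` at real
  -- points; the identity principle then gives equality.
  have hg : SliceHolomorphicOn J (fun z => (1 / 2 : ℝ) • (f (slice I z) +
      f (slice I (starRingEnd ℂ z))) +
      J * ((1 / 2 : ℝ) • (I * (f (slice I (starRingEnd ℂ z)) - f (slice I z))))) (sliceSet J Ω) := by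
    intro z hz
    rw [hsets] at hz
    obtain ⟨h1, e1⟩ := hfI z hz
    obtain ⟨h2, e2⟩ := hfI _ (conj_mem_sliceSet hΩ hI hz)
    have h3 := h1.hasFDerivAt
    have h4 : HasFDerivAt (fun z => f (slice I (starRingEnd ℂ z)))
        (fderiv ℝ (fun z => f (slice I z)) (starRingEnd ℂ z) ∘L
          (Complex.conjCLE : ℂ →L[ℝ] ℂ)) z :=
      HasFDerivAt.comp z (g := fun z => f (slice I z)) h2.hasFDerivAt
        (Complex.conjCLE : ℂ →L[ℝ] ℂ).hasFDerivAt
    have h5 := ((h3.add h4).const_smul (1 / 2 : ℝ)).add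
      ((((h4.sub h3).const_mul I).const_smul (1 / 2 : ℝ)).const_mul J)
    refine ⟨h5.differentiableAt, ?_⟩
    have h6 := h5.fderiv
    erw [h6]
    simp only [add_apply, smul_apply, sub_apply, ContinuousLinearMap.comp_apply,
      ContinuousLinearEquiv.coe_coe, Complex.conjCLE_apply, Complex.conj_I, map_one, map_neg, e1, e2,
      smul_eq_mul]
    simp only [mul_add, mul_sub, mul_neg, mul_smul_comm, hII, hJJ, smul_add, smul_sub, smul_neg]
    abel
  refine SliceHolomorphicOn.eqOn hJ (isOpen_sliceSet J hopen)
    (hΩ.connected_slice J hJ).isPreconnected (hf.sliceHolomorphicOn hopen hJ) hg (x := x) ?_ ?_ hz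
  · simpa [sliceSet, slice_ofReal] using hx
  · intro y _
    simp only [Complex.conj_ofReal, slice_ofReal, sub_self, mul_zero, smul_zero, add_zero]
    rw [← two_smul ℝ, smul_smul]
    norm_num

lemma norm_inv_smul_im_mem {q : ℍ} (hq : q.im ≠ 0) : ‖q.im‖⁻¹ • q.im ∈ imagUnits := by
  show (‖q.im‖⁻¹ • q.im) ^ 2 = -1
  have h : q.im ^ 2 = -((‖q.im‖ ^ 2 : ℝ) : ℍ) := by
    rw [Quaternion.sq_eq_neg_normSq.2 (by simp), Quaternion.normSq_eq_norm_mul_self, pow_two]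
  have h0 : ‖q.im‖ ≠ 0 := norm_ne_zero_iff.2 hq
  rw [smul_pow, h, smul_neg, ← Quaternion.coe_smul, smul_eq_mul, ← mul_pow, inv_mul_cancel₀ h0]
  simp

lemma slice_norm_inv_smul_im {q : ℍ} (hq : q.im ≠ 0) :
    slice (‖q.im‖⁻¹ • q.im) ⟨q.re, ‖q.im‖⟩ = q := by
  have h0 : ‖q.im‖ ≠ 0 := norm_ne_zero_iff.2 hq
  rw [slice, Quaternion.coe_mul_eq_smul, smul_smul, mul_inv_cancel₀ h0, one_smul,
    Quaternion.re_add_im]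

/-- A regular function on a symmetric slice domain is continuous. -/
theorem RegularOn.continuousOn {f : ℍ → ℍ} {Ω : Set ℍ} (hΩ : IsSymmetricSliceDomain Ω)
    (hf : RegularOn f Ω) : ContinuousOn f Ω := by
  obtain ⟨I, hI⟩ := exists_mem_imagUnits
  have hopen := hΩ.isOpenDomain.1
  -- `ζ` is continuous and moves every point of `Ω` into one fixed slice, where `f` is continuous.
  set ζ : ℍ → ℂ := fun q => ⟨q.re, ‖q.im‖⟩ with hζ
  have hζc : Continuous ζ := by
    have h : ζ = fun q => (q.re : ℂ) + ((‖q.im‖ : ℝ) : ℂ) * Complex.I := by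
      ext1 q
      exact Complex.mk_eq_add_mul_I _ _
    rw [h]
    have h1 := Quaternion.continuous_re
    have h2 := Quaternion.continuous_im
    fun_prop
  have hζmem {q : ℍ} (hq : q ∈ Ω) : ζ q ∈ sliceSet I Ω := by
    by_cases h0 : q.im = 0
    · have h : ζ q = (q.re : ℂ) := by simp [hζ, h0, Complex.ext_iff]
      have h' : (q.re : ℍ) = q := by
        conv_rhs => rw [← Quaternion.re_add_im q, h0, add_zero]
      rw [h, sliceSet, mem_preimage, slice_ofReal, h']
      exact hq
    · exact hΩ.symmetric _ (norm_inv_smul_im_mem h0) I hI _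
        (by rw [slice_norm_inv_smul_im h0]; exact hq)
  set α : ℂ → ℍ := fun z => (1 / 2 : ℝ) • (f (slice I z) + f (slice I (starRingEnd ℂ z))) with hα
  set β : ℂ → ℍ := fun z =>
    (1 / 2 : ℝ) • (I * (f (slice I (starRingEnd ℂ z)) - f (slice I z))) with hβ
  have hfc := (hf.sliceHolomorphicOn hopen hI).continuousOn
  have hfc' : ContinuousOn (fun z => f (slice I (starRingEnd ℂ z))) (sliceSet I Ω) :=
    hfc.comp Complex.continuous_conj.continuousOn fun z hz => conj_mem_sliceSet hΩ hI hz
  have hαc : ContinuousOn (fun q => α (ζ q)) Ω :=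
    ContinuousOn.comp (g := α) ((hfc.add hfc').const_smul (1 / 2 : ℝ)) hζc.continuousOn fun q hq => hζmem hq
  have hβc : ContinuousOn (fun q => β (ζ q)) Ω :=
    ContinuousOn.comp (g := β) ((continuousOn_const.mul (hfc'.sub hfc)).const_smul (1 / 2 : ℝ))
      hζc.continuousOn fun q hq => hζmem hq
  have hβ0 {q : ℍ} (h0 : q.im = 0) : β (ζ q) = 0 := by
    have h : ζ q = (q.re : ℂ) := by simp [hζ, h0, Complex.ext_iff]
    simp [hβ, h]
  -- At real `q` the convention `0⁻¹ = 0` removes the second term. The direction of `q.im` jumps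
  -- there, but it has norm at most `1` and multiplies `β (ζ q)`, which tends to `0`.
  have hrep : EqOn f (fun q => α (ζ q) + (‖q.im‖⁻¹ • q.im) * β (ζ q)) Ω := by
    intro q hq
    by_cases h0 : q.im = 0
    · have h : ζ q = (q.re : ℂ) := by simp [hζ, h0, Complex.ext_iff]
      have h' : (q.re : ℍ) = q := by
        conv_rhs => rw [← Quaternion.re_add_im q, h0, add_zero]
      simp only [h0, smul_zero, zero_mul, add_zero]
      rw [h, hα]
      simp only [Complex.conj_ofReal, slice_ofReal, h']
      rw [← two_smul ℝ, smul_smul]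
      norm_num
    · have h := hf.representation hΩ hI (norm_inv_smul_im_mem h0) (z := ζ q)
        (by rw [slice_norm_inv_smul_im h0]; exact hq)
      rw [slice_norm_inv_smul_im h0] at h
      exact h
  refine ContinuousOn.congr (hαc.add fun q hq => ?_) hrep
  by_cases h0 : q.im = 0
  · have h1 : Tendsto (fun p => ‖β (ζ p)‖) (𝓝[Ω] q) (𝓝 0) := by
      have := (hβc q hq).norm
      rwa [ContinuousWithinAt, hβ0 h0, norm_zero] at this
    rw [ContinuousWithinAt, hβ0 h0, mul_zero]
    refine squeeze_zero_norm (fun p => ?_) h1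
    rw [norm_mul, norm_smul, norm_inv, norm_norm]
    exact mul_le_of_le_one_left (norm_nonneg _) (inv_mul_le_one)
  · have hc := Quaternion.continuous_im.continuousWithinAt (s := Ω) (x := q)
    exact ((hc.norm.inv₀ (norm_ne_zero_iff.2 h0)).smul hc).mul (hβc q hq)

/-! ### Composition of pluriharmonic functions with holomorphic curves -/

lemma fderiv_fderiv_comp {E F G : Type*} [NormedAddCommGroup E] [NormedSpace ℝ E]
    [NormedAddCommGroup F] [NormedSpace ℝ F] [NormedAddCommGroup G] [NormedSpace ℝ G]
    {g : F → G} {f : E → F} {x : E} (hg : ContDiffAt ℝ 2 g (f x)) (hf : ContDiffAt ℝ 2 f x)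
    (v w : E) :
    fderiv ℝ (fderiv ℝ (g ∘ f)) x v w =
      fderiv ℝ (fderiv ℝ g) (f x) (fderiv ℝ f x v) (fderiv ℝ f x w) +
        fderiv ℝ g (f x) (fderiv ℝ (fderiv ℝ f) x v w) := by
  have hf1 : ∀ᶠ y in 𝓝 x, DifferentiableAt ℝ f y :=
    (hf.eventually (by simp)).mono fun y hy => hy.differentiableAt (by simp)
  have hg1 : ∀ᶠ y in 𝓝 x, DifferentiableAt ℝ g (f y) :=
    hf.continuousAt.eventually
      ((hg.eventually (by simp)).mono fun y hy => hy.differentiableAt (by simp))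
  have heq : fderiv ℝ (g ∘ f) =ᶠ[𝓝 x] fun y => (fderiv ℝ g (f y)).comp (fderiv ℝ f y) := by
    filter_upwards [hf1, hg1] with y h1 h2
    exact fderiv_comp y h2 h1
  have hg2 : DifferentiableAt ℝ (fderiv ℝ g) (f x) :=
    (hg.fderiv_right (m := 1) (by norm_num)).differentiableAt (by simp)
  have hf2 : DifferentiableAt ℝ (fderiv ℝ f) x :=
    (hf.fderiv_right (m := 1) (by norm_num)).differentiableAt (by simp)
  have h := (hg2.hasFDerivAt.comp x hf1.self_of_nhds.hasFDerivAt).clm_comp hf2.hasFDerivAt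
  rw [heq.fderiv_eq]
  erw [h.fderiv]
  simp [add_comm]

lemma laplacian_comp {F : Type*} [NormedAddCommGroup F] [NormedSpace ℝ F]
    {g : F → ℝ} {f : ℂ → F} {z : ℂ} (hg : ContDiffAt ℝ 2 g (f z)) (hf : ContDiffAt ℝ 2 f z) :
    Laplacian.laplacian (g ∘ f) z =
      fderiv ℝ (fderiv ℝ g) (f z) (fderiv ℝ f z 1) (fderiv ℝ f z 1) +
      fderiv ℝ (fderiv ℝ g) (f z) (fderiv ℝ f z Complex.I) (fderiv ℝ f z Complex.I) +
        fderiv ℝ g (f z) (Laplacian.laplacian f z) := by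
  simp only [laplacian_eq_iteratedFDeriv_complexPlane, iteratedFDeriv_two_apply,
    Matrix.cons_val_zero, Matrix.cons_val_one, fderiv_fderiv_comp hg hf, map_add]
  ring

lemma sliceHolomorphicOn_line (I a b : ℍ) (D : Set ℂ) :
    SliceHolomorphicOn I (fun z => a + slice I z * b) D := by
  intro z _
  have h : HasFDerivAt (fun z => a + slice I z * b)
      ((ContinuousLinearMap.mul ℝ ℍ).flip b ∘L sliceCLM I) z :=
    (((ContinuousLinearMap.mul ℝ ℍ).flip b ∘L sliceCLM I).hasFDerivAt).const_add a
  refine ⟨h.differentiableAt, ?_⟩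
  rw [h.fderiv]
  simp

lemma fderiv_line (I a b : ℍ) (z w : ℂ) :
    fderiv ℝ (fun z => a + slice I z * b) z w = slice I w * b := by
  have h : HasFDerivAt (fun z => a + slice I z * b)
      ((ContinuousLinearMap.mul ℝ ℍ).flip b ∘L sliceCLM I) z :=
    (((ContinuousLinearMap.mul ℝ ℍ).flip b ∘L sliceCLM I).hasFDerivAt).const_add a
  rw [h.fderiv]
  simp

/-- By `laplacian_comp`, the Laplacian depends on the curve only through its point, its first
derivatives and its own Laplacian. The curve and its tangent complex line share the first two, and
both have zero Laplacian. -/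
theorem PluriharmonicOn.harmonicOn_comp {I : ℍ} (hI : I ∈ imagUnits) {u : ℍ → EReal} {Ω : Set ℍ}
    (hΩ : IsOpen Ω) (hu : PluriharmonicOn I u Ω) {f : ℂ → ℍ} {D : Set ℂ} (hD : IsOpen D)
    (hf : SliceHolomorphicOn I f D) (hmaps : MapsTo f D Ω) :
    HarmonicOn (fun z => u (f z)) D := by
  obtain ⟨hfin, hC, hline⟩ := hu
  refine ⟨fun z hz => hfin _ (hmaps hz), fun z hz => ?_⟩
  have hCat {q : ℍ} (hq : q ∈ Ω) : ContDiffAt ℝ 2 (fun q => (u q).toReal) q :=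
    hC.contDiffAt (hΩ.mem_nhds hq)
  refine ⟨(hCat (hmaps hz)).comp z (hf.contDiffAt hI hD hz), ?_⟩
  filter_upwards [hD.mem_nhds hz] with w hw
  have h1 := laplacian_comp (hCat (hmaps hw)) (hf.contDiffAt hI hD hw)
  set b := fderiv ℝ f w 1 with hb
  have hp : f w + slice I 0 * b = f w := by simp
  have hholo := sliceHolomorphicOn_line I (f w) b univ
  have h2 := laplacian_comp (f := fun z => f w + slice I z * b) (z := 0)
    (by rw [hp]; exact hCat (hmaps hw)) (hholo.contDiffAt hI isOpen_univ (mem_univ _))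
  have h3 := ((hline (f w) (hmaps hw) b).2 0 (by simpa using hmaps hw)).2.self_of_nhds
  rw [hholo.laplacian_eq_zero hI isOpen_univ (mem_univ _), fderiv_line, fderiv_line, hp, slice_one,
    slice_I, one_mul] at h2
  rw [hf.laplacian_eq_zero hI hD hw, (hf w hw).2, ← hb] at h1
  exact (h1.trans h2.symm).trans h3

/-! ### Smoothness from mean values over circles -/

section RadialBump

variable {E : Type*} [NormedAddCommGroup E]

/-- A smooth radial function that is positive exactly on the ball of radius `ρ`. -/
noncomputable def radialBump (ρ : ℝ) (q : E) : ℝ := Real.smoothTransition (ρ ^ 2 - ‖q‖ ^ 2)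

lemma radialBump_nonneg (ρ : ℝ) (q : E) : 0 ≤ radialBump ρ q := Real.smoothTransition.nonneg _

lemma radialBump_eq_zero {ρ : ℝ} (hρ : 0 < ρ) {q : E} (hq : q ∉ ball (0 : E) ρ) :
    radialBump ρ q = 0 := by
  refine Real.smoothTransition.zero_of_nonpos ?_
  rw [mem_ball_zero_iff, not_lt] at hq
  nlinarith

lemma radialBump_lower {ρ : ℝ} (hρ : 0 < ρ) :
    ∃ c : ℝ, 0 < c ∧ ∀ q ∈ ball (0 : E) (ρ / 2), c ≤ radialBump ρ q := by
  refine ⟨Real.smoothTransition (ρ ^ 2 - (ρ / 2) ^ 2),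
    Real.smoothTransition.pos_of_pos (by nlinarith), fun q hq => ?_⟩
  refine Real.smoothTransition.monotone ?_
  rw [mem_ball_zero_iff] at hq
  nlinarith [norm_nonneg q]

variable [InnerProductSpace ℝ E]

lemma radialBump_map (ρ : ℝ) (R : E ≃ₗᵢ[ℝ] E) (q : E) : radialBump ρ (R q) = radialBump ρ q := by
  simp [radialBump]

lemma contDiff_radialBump (ρ : ℝ) : ContDiff ℝ 2 (radialBump ρ : E → ℝ) :=
  Real.smoothTransition.contDiff.comp (contDiff_const.sub (contDiff_norm_sq ℝ))

lemma hasCompactSupport_radialBump [FiniteDimensional ℝ E] {ρ : ℝ} (hρ : 0 < ρ) :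
    HasCompactSupport (radialBump ρ : E → ℝ) :=
  HasCompactSupport.intro (isCompact_closedBall (0 : E) ρ) fun _ hq =>
    radialBump_eq_zero hρ fun h => hq (ball_subset_closedBall h)

variable [FiniteDimensional ℝ E] [MeasurableSpace E] [BorelSpace E]

lemma integral_radialBump_pos {ρ : ℝ} (hρ : 0 < ρ) :
    0 < ∫ q : E, radialBump ρ q := by
  refine (contDiff_radialBump ρ).continuous.integral_pos_of_hasCompactSupport_nonneg_nonzero
    (hasCompactSupport_radialBump hρ) (radialBump_nonneg ρ) (x := 0) ?_
  obtain ⟨c, hc, h⟩ := radialBump_lower (E := E) hρ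
  exact (hc.trans_le (h 0 (mem_ball_self (by positivity)))).ne'

/-- The integral is unchanged when `q` is rotated by any `R θ`; averaging over `θ` and exchanging
integrals turns `g (p - R θ q)` into `g p`. With values in `[0, ∞]`, Tonelli applies before
integrability of `g` is known. -/
lemma lintegral_radialBump_mul {R : ℝ → E ≃ₗᵢ[ℝ] E} (hR : Continuous fun x : ℝ × E => R x.1 x.2)
    {ν : Measure ℝ} [IsFiniteMeasure ν] [NeZero ν] {g : E → ℝ≥0∞} (hg : Measurable g) {p : E}
    {ρ : ℝ} (hρ : 0 < ρ)
    (hmean : ∀ q ∈ ball (0 : E) ρ, ∫⁻ θ, g (p - R θ q) ∂ν = ν univ * g p) :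
    ∫⁻ q, ENNReal.ofReal (radialBump ρ q) * g (p - q) =
      g p * ∫⁻ q : E, ENNReal.ofReal (radialBump ρ q) := by
  have hφ : Measurable fun q : E => ENNReal.ofReal (radialBump ρ q) :=
    (contDiff_radialBump ρ).continuous.measurable.ennreal_ofReal
  have h0 : ν univ ≠ 0 := by simpa using NeZero.ne ν
  have hrot (θ : ℝ) : ∫⁻ q, ENNReal.ofReal (radialBump ρ q) * g (p - q) =
      ∫⁻ q, ENNReal.ofReal (radialBump ρ q) * g (p - R θ q) := by
    have hm : Measurable fun q : E => ENNReal.ofReal (radialBump ρ q) * g (p - q) :=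
      hφ.mul (hg.comp (by fun_prop : Measurable fun q : E => p - q))
    rw [← (R θ).measurePreserving.lintegral_comp hm]
    simp [radialBump_map]
  have h : ν univ * ∫⁻ q, ENNReal.ofReal (radialBump ρ q) * g (p - q) =
      ν univ * (g p * ∫⁻ q : E, ENNReal.ofReal (radialBump ρ q)) := by
    calc ν univ * ∫⁻ q, ENNReal.ofReal (radialBump ρ q) * g (p - q)
        = ∫⁻ _ : ℝ, (∫⁻ q, ENNReal.ofReal (radialBump ρ q) * g (p - q)) ∂ν := by
          rw [lintegral_const, mul_comm]
      _ = ∫⁻ θ, (∫⁻ q, ENNReal.ofReal (radialBump ρ q) * g (p - R θ q)) ∂ν :=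
          lintegral_congr fun θ => hrot θ
      _ = ∫⁻ q, (∫⁻ θ, ENNReal.ofReal (radialBump ρ q) * g (p - R θ q) ∂ν) := by
          refine lintegral_lintegral_swap (Measurable.aemeasurable ?_)
          exact (hφ.comp measurable_snd).mul (hg.comp (measurable_const.sub hR.measurable))
      _ = ∫⁻ q, ENNReal.ofReal (radialBump ρ q) * (ν univ * g p) := by
          refine lintegral_congr fun q => ?_
          have hRq : Measurable fun θ => R θ q :=
            (hR.comp (by fun_prop : Continuous fun θ : ℝ => (θ, q))).measurable
          have hm : Measurable fun θ => g (p - R θ q) :=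
            hg.comp (by fun_prop : Measurable fun θ => p - R θ q)
          rw [lintegral_const_mul _ hm]
          by_cases hq : q ∈ ball (0 : E) ρ
          · rw [hmean q hq]
          · rw [radialBump_eq_zero hρ hq]; simp
      _ = ν univ * (g p * ∫⁻ q : E, ENNReal.ofReal (radialBump ρ q)) := by
          rw [lintegral_mul_const _ hφ]
          ring
  exact (ENNReal.mul_right_inj h0 (measure_ne_top ν _)).1 h

/-- A nonnegative measurable function whose mean over every small rotation orbit around a point is
its value at this point is of class `C²`. -/
theorem contDiffAt_of_mean_value {R : ℝ → E ≃ₗᵢ[ℝ] E}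
    (hR : Continuous fun x : ℝ × E => R x.1 x.2)
    {ν : Measure ℝ} [IsFiniteMeasure ν] [NeZero ν] {g : E → ℝ} (hg : Measurable g)
    (hg0 : ∀ q, 0 ≤ g q) {p₀ : E} {r : ℝ} (hr : 0 < r)
    (hmean : ∀ p ∈ ball p₀ r, ∀ q ∈ ball (0 : E) r,
      ∫⁻ θ, ENNReal.ofReal (g (p - R θ q)) ∂ν = ν univ * ENNReal.ofReal (g p)) :
    ContDiffAt ℝ 2 g p₀ := by
  have hφint (ρ : ℝ) (hρ : 0 < ρ) : Integrable (radialBump ρ : E → ℝ) :=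
    (contDiff_radialBump ρ).continuous.integrable_of_hasCompactSupport
      (hasCompactSupport_radialBump hρ)
  have hconv {p : E} (hp : p ∈ ball p₀ r) {ρ : ℝ} (hρ : 0 < ρ) (hρr : ρ ≤ r) :
      ∫⁻ q, ENNReal.ofReal (radialBump ρ q * g (p - q)) =
        ENNReal.ofReal (g p * ∫ q : E, radialBump ρ q) := by
    rw [ENNReal.ofReal_mul (hg0 p),
      ofReal_integral_eq_lintegral_ofReal (hφint ρ hρ) (ae_of_all _ (radialBump_nonneg ρ)),
      ← lintegral_radialBump_mul hR (ν := ν) hg.ennreal_ofReal hρ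
        fun q hq => hmean p hp q (ball_subset_ball hρr hq)]
    exact lintegral_congr fun q => ENNReal.ofReal_mul (radialBump_nonneg ρ q)
  -- The reproducing identity at `p₀` has a finite right-hand side, and the bump is bounded below on
  -- the half ball.
  have hint : IntegrableOn g (ball p₀ (r / 2)) := by
    refine ⟨hg.aestronglyMeasurable, ?_⟩
    obtain ⟨c, hc, hcb⟩ := radialBump_lower (E := E) hr
    have h1 : ∫⁻ q, ENNReal.ofReal (radialBump r (p₀ - q) * g q) < ∞ := by
      have h2 := hconv (mem_ball_self hr) hr le_rfl
      rw [← lintegral_sub_left_eq_self _ p₀] at h2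
      simp only [sub_sub_cancel] at h2
      rw [h2]
      exact ENNReal.ofReal_lt_top
    rw [hasFiniteIntegral_iff_ofReal (ae_of_all _ hg0)]
    have h3 : ENNReal.ofReal c * ∫⁻ q in ball p₀ (r / 2), ENNReal.ofReal (g q) < ∞ := by
      rw [← lintegral_const_mul _ hg.ennreal_ofReal]
      refine lt_of_le_of_lt ?_ h1
      refine (setLIntegral_mono' measurableSet_ball fun q hq => ?_).trans
        (setLIntegral_le_lintegral _ _)
      rw [← ENNReal.ofReal_mul hc.le]
      refine ENNReal.ofReal_le_ofReal (mul_le_mul_of_nonneg_right (hcb _ ?_) (hg0 q))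
      rwa [mem_ball_zero_iff, ← dist_eq_norm, dist_comm]
    refine (ENNReal.mul_lt_top_iff.1 h3).elim (fun h => h.2) ?_
    rintro (h | h)
    · exact absurd (ENNReal.ofReal_eq_zero.1 h) (not_le.2 hc)
    · rw [h]; simp
  set g₁ : E → ℝ := (ball p₀ (r / 2)).indicator g with hg₁
  have hg₁int : Integrable g₁ := hint.integrable_indicator measurableSet_ball
  have hρ : 0 < r / 4 := by positivity
  have hsmooth := (hasCompactSupport_radialBump (E := E) hρ).contDiff_convolution_left
    (ContinuousLinearMap.mul ℝ ℝ) (μ := volume) (contDiff_radialBump (r / 4))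
    hg₁int.locallyIntegrable
  have hpos := integral_radialBump_pos (E := E) hρ
  -- For `p` within `r / 4` of `p₀` and `q` in the support ball of radius `r / 4`, the point `p - q`
  -- stays where `g₁ = g`.
  have heq : g =ᶠ[𝓝 p₀] fun p => (∫ q : E, radialBump (r / 4) q)⁻¹ *
      convolution (radialBump (r / 4)) g₁ (ContinuousLinearMap.mul ℝ ℝ) volume p := by
    filter_upwards [ball_mem_nhds p₀ hρ] with p hp
    have hpr : p ∈ ball p₀ r := ball_subset_ball (by linarith) hp
    have h1 : convolution (radialBump (r / 4)) g₁ (ContinuousLinearMap.mul ℝ ℝ) volume p =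
        ∫ q : E, radialBump (r / 4) q * g (p - q) := by
      refine integral_congr_ae (ae_of_all _ fun q => ?_)
      simp only [ContinuousLinearMap.mul_apply']
      by_cases hq : q ∈ ball (0 : E) (r / 4)
      · have : p - q ∈ ball p₀ (r / 2) := by
          rw [mem_ball_iff_norm] at hp ⊢
          rw [mem_ball_zero_iff] at hq
          calc ‖p - q - p₀‖ = ‖(p - p₀) - q‖ := by congr 1; abel
            _ ≤ ‖p - p₀‖ + ‖q‖ := norm_sub_le _ _
            _ < r / 2 := by linarith
        rw [hg₁, indicator_of_mem this]
      · rw [radialBump_eq_zero hρ hq, zero_mul, zero_mul]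
    have h2 : ∫ q : E, radialBump (r / 4) q * g (p - q) =
        g p * ∫ q : E, radialBump (r / 4) q := by
      have hm : Measurable fun q : E => radialBump (r / 4) q * g (p - q) :=
        (contDiff_radialBump _).continuous.measurable.mul
          (hg.comp (by fun_prop : Measurable fun q : E => p - q))
      rw [integral_eq_lintegral_of_nonneg_ae
        (ae_of_all _ fun q => mul_nonneg (radialBump_nonneg _ q) (hg0 _))
        hm.aestronglyMeasurable,
        hconv hpr hρ (by linarith), ENNReal.toReal_ofReal (mul_nonneg (hg0 p) hpos.le)]
    rw [h1, h2]
    field_simp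
  exact (contDiff_const.mul hsmooth).contDiffAt.congr_of_eventuallyEq heq

end RadialBump

/-- Left multiplication by `exp (I * θ)`. -/
noncomputable def sliceRotation {I : ℍ} (hI : I ∈ imagUnits) (θ : ℝ) : ℍ ≃ₗᵢ[ℝ] ℍ :=
  LinearIsometry.toLinearIsometryEquiv
    { toLinearMap := LinearMap.mulLeft ℝ (slice I (circleMap 0 1 θ))
      norm_map' := fun q => by simp [norm_slice hI] } rfl

lemma sliceRotation_apply {I : ℍ} (hI : I ∈ imagUnits) (θ : ℝ) (q : ℍ) :
    sliceRotation hI θ q = slice I (circleMap 0 1 θ) * q := rfl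

lemma UscOn.measurable_indicator_sub {X : Type*} [TopologicalSpace X] [MeasurableSpace X]
    [BorelSpace X] {u : X → EReal} {s : Set X} (hu : UscOn u s) (hs : MeasurableSet s) (C : ℝ) :
    Measurable (s.indicator fun q => C - (u q).toReal) := by
  refine measurable_of_restrict_of_restrict_compl hs ?_ ?_
  · have h : Measurable (s.domRestrict u) :=
      (upperSemicontinuousOn_iff_restrict.2 hu.2).measurable
    have h' : Measurable fun q : s => C - (s.domRestrict u q).toReal :=
      measurable_const.sub h.ereal_toReal
    convert h' using 1
    ext q
    simp
  · have h : sᶜ.domRestrict (s.indicator fun q => C - (u q).toReal) = fun _ => 0 := by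
      ext q
      exact indicator_of_notMem q.2 _
    rw [h]
    exact measurable_const

/-- An upper semicontinuous real function that is harmonic along all complex lines is `C²`. -/
theorem contDiffOn_of_harmonicOn_lines {I : ℍ} (hI : I ∈ imagUnits) {u : ℍ → EReal} {Ω : Set ℍ}
    (hΩ : IsOpen Ω) (hu : UscOn u Ω)
    (hline : ∀ a ∈ Ω, ∀ b : ℍ,
      HarmonicOn (fun z => u (a + slice I z * b)) {z : ℂ | a + slice I z * b ∈ Ω}) :
    ContDiffOn ℝ 2 (fun q => (u q).toReal) Ω := by
  let : MeasurableSpace ℍ := borel ℍ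
  have : BorelSpace ℍ := ⟨rfl⟩
  intro p₀ hp₀
  refine ContDiffAt.contDiffWithinAt ?_
  have hfin {q : ℍ} (hq : q ∈ Ω) : ((u q).toReal : EReal) = u q :=
    have h := (hline q hq 0).1 0 (by simpa using hq)
    EReal.coe_toReal (by simpa using h.2) (by simpa using h.1)
  -- Upper semicontinuity gives `u < C` near `p₀`, so `C - u` is nonnegative there, as the mean
  -- value criterion requires; it is measurable for the same reason.
  set C := (u p₀).toReal + 1 with hC
  have hlt : u p₀ < (C : EReal) := by
    rw [← hfin hp₀, EReal.coe_lt_coe_iff]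
    linarith
  have hnear : ∀ᶠ q in 𝓝 p₀, u q < (C : EReal) := by
    have := hu.2 _ hp₀ _ hlt
    rwa [hΩ.nhdsWithin_eq hp₀] at this
  obtain ⟨s, hs, hball⟩ := nhds_basis_ball.eventually_iff.1 (hnear.and (hΩ.mem_nhds hp₀))
  have hballΩ : ball p₀ s ⊆ Ω := fun q hq => (hball hq).2
  set g : ℍ → ℝ := (ball p₀ s).indicator fun q => C - (u q).toReal with hg
  have hgeq {q : ℍ} (hq : q ∈ ball p₀ s) : g q = C - (u q).toReal := indicator_of_mem hq _
  have hg0 (q : ℍ) : 0 ≤ g q := by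
    refine indicator_nonneg (fun q hq => ?_) q
    have h := (hball hq).1
    rw [← hfin (hballΩ hq), EReal.coe_lt_coe_iff] at h
    linarith
  have hgm : Measurable g := (hu.mono hballΩ).measurable_indicator_sub measurableSet_ball C
  have hR : Continuous fun x : ℝ × ℍ => sliceRotation hI x.1 x.2 := by
    simp only [sliceRotation_apply]
    exact ((continuous_slice I).comp ((continuous_circleMap 0 1).comp continuous_fst)).mul
      continuous_snd
  have : NeZero (volume.restrict (Ioc 0 (2 * Real.pi))) := ⟨by
    simp [Measure.restrict_eq_zero, Real.pi_pos]⟩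
  have hmain : ContDiffAt ℝ 2 g p₀ := by
    refine contDiffAt_of_mean_value hR (ν := volume.restrict (Ioc 0 (2 * Real.pi))) hgm hg0
      (half_pos hs) fun p hp q hq => ?_
    have hin (z : ℂ) (hz : z ∈ closedBall (0 : ℂ) 1) : p + slice I z * (-q) ∈ ball p₀ s := by
      rw [mem_ball_iff_norm] at hp ⊢
      rw [mem_ball_zero_iff] at hq
      rw [mem_closedBall_zero_iff] at hz
      calc ‖p + slice I z * (-q) - p₀‖ = ‖(p - p₀) + slice I z * (-q)‖ := by congr 1; abel
        _ ≤ ‖p - p₀‖ + ‖slice I z * (-q)‖ := norm_add_le _ _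
        _ = ‖p - p₀‖ + ‖z‖ * ‖q‖ := by rw [norm_mul, norm_neg, norm_slice hI]
        _ < s := by nlinarith [norm_nonneg q]
    have hpb : p ∈ ball p₀ s := ball_subset_ball (by linarith) hp
    have hharm : HarmonicOnNhd (fun z => C - (u (p + slice I z * (-q))).toReal)
        (closedBall 0 |1|) := by
      intro z hz
      rw [abs_one] at hz
      exact (harmonicAt_const C).sub ((hline p (hballΩ hpb) (-q)).2 z (hballΩ (hin z hz)))
    -- The circle mean value on the line through `p` in direction `-q` is exactly the average of `g`
    -- over the orbit `p - e^{Iθ} q`.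
    have hmv := hharm.circleAverage_eq
    have hcirc (θ : ℝ) : circleMap (0 : ℂ) 1 θ ∈ closedBall (0 : ℂ) 1 :=
      circleMap_mem_closedBall _ zero_le_one _
    have hgc (θ : ℝ) : g (p - sliceRotation hI θ q) =
        C - (u (p + slice I (circleMap 0 1 θ) * (-q))).toReal := by
      rw [← hgeq (hin _ (hcirc θ)), sliceRotation_apply, mul_neg, sub_eq_add_neg]
    have hcont : Continuous fun θ : ℝ => g (p - sliceRotation hI θ q) := by
      simp only [hgc]
      exact ContinuousOn.comp_continuous (s := closedBall (0 : ℂ) 1)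
        (g := fun z => C - (u (p + slice I z * (-q))).toReal)
        (by simpa using hharm.continuousOn) (continuous_circleMap 0 1) hcirc
    have hint : IntegrableOn (fun θ : ℝ => g (p - sliceRotation hI θ q)) (Ioc 0 (2 * Real.pi)) :=
      (hcont.integrableOn_Icc).mono_set Ioc_subset_Icc_self
    rw [← ofReal_integral_eq_lintegral_ofReal hint (ae_of_all _ fun θ => hg0 _),
      ← intervalIntegral.integral_of_le Real.two_pi_pos.le]
    rw [Real.circleAverage_def, smul_eq_mul, inv_mul_eq_iff_eq_mul₀ Real.two_pi_pos.ne'] at hmv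
    simp only [hgc, hmv]
    rw [hgeq hpb]
    simp [ENNReal.ofReal_mul Real.two_pi_pos.le]
  have heq : (fun q => (u q).toReal) =ᶠ[𝓝 p₀] fun q => C - g q := by
    filter_upwards [ball_mem_nhds p₀ hs] with q hq
    rw [hgeq hq]
    ring
  exact (contDiffAt_const.sub hmain).congr_of_eventuallyEq heq

/-! ### Characterizations by composition with regular functions -/

lemma isOpen_line_preimage (I a b : ℍ) {Ω : Set ℍ} (hΩ : IsOpen Ω) :
    IsOpen {z : ℂ | a + slice I z * b ∈ Ω} :=
  hΩ.preimage (continuous_const.add ((continuous_slice I).mul continuous_const))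

lemma exists_ball_mapsTo_affine {Ω : Set ℍ} (hΩ : IsOpen Ω) {a : ℍ} (ha : a ∈ Ω) (b : ℍ) :
    ∃ r > 0, MapsTo (fun q => a + q * b) (ball 0 r) Ω := by
  have h : ContinuousAt (fun q : ℍ => a + q * b) 0 := by fun_prop
  exact nhds_basis_ball.mem_iff.1 (h (hΩ.mem_nhds (by simpa using ha)))

lemma line_shift (I a b : ℍ) (z w : ℂ) :
    a + slice I (z + w) * b = a + slice I z * b + slice I w * b := by
  rw [slice_add, add_mul, add_assoc]

theorem StronglySubharmonicOn.slicewiseSubharmonicOn_comp {u : ℍ → EReal} {Ω Ω' : Set ℍ}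
    (hΩ : IsOpen Ω) (hu : StronglySubharmonicOn u Ω) {f : ℍ → ℍ} (hΩ' : IsOpen Ω')
    (hf : RegularOn f Ω') (hmaps : MapsTo f Ω' Ω) : SlicewiseSubharmonicOn (u ∘ f) Ω' := by
  intro I hI
  obtain ⟨hus, hline⟩ := hu I hI
  have hfI := hf.sliceHolomorphicOn hΩ' hI
  have hmapsI : MapsTo (fun z => f (slice I z)) (sliceSet I Ω') Ω := fun z hz => hmaps hz
  exact (viscositySubharmonicOn_comp hI hΩ hus.1
    (fun a ha b => (hline a ha b).viscositySubharmonicOn (isOpen_line_preimage I a b hΩ))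
    (isOpen_sliceSet I hΩ') hfI hmapsI).subharmonicOn (hus.1.comp hfI.continuousOn hmapsI)

/-- Only a small ball around each point of a line is sure to map into `Ω`. This suffices, since the
viscosity condition is local. -/
theorem stronglySubharmonicOn_of_comp {u : ℍ → EReal} {Ω : Set ℍ} (hΩ : IsOpen Ω) (hu : InUs u Ω)
    (H : ∀ (Ω' : Set ℍ) (f : ℍ → ℍ), IsSymmetricSliceDomain Ω' → RegularOn f Ω' →
      MapsTo f Ω' Ω → SlicewiseSubharmonicOn (u ∘ f) Ω') : StronglySubharmonicOn u Ω := by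
  intro I hI
  refine ⟨hu, fun a _ b => ViscositySubharmonicOn.subharmonicOn ?_ ?_⟩
  · exact hu.1.comp
      (continuous_const.add ((continuous_slice I).mul continuous_const)).continuousOn fun z hz => hz
  · intro z₀ hz₀ h hh k hk heq hev
    obtain ⟨r, hr, hmaps⟩ := exists_ball_mapsTo_affine hΩ hz₀ b
    have hsub := H _ _ (isSymmetricSliceDomain_ball hr)
      (regularOn_affine (a + slice I z₀ * b) b _) hmaps I hI
    refine hsub.viscositySubharmonicOn (isOpen_sliceSet I isOpen_ball) 0
      (by simpa [sliceSet] using hr) h hh k hk (by simpa using heq) ?_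
    filter_upwards [hev] with w hw
    rw [line_shift] at hw
    simpa using hw

/-- Affine maps on small balls give harmonicity along lines, which is local; finiteness comes from
constant maps, and `C²` regularity from `contDiffOn_of_harmonicOn_lines`. -/
theorem stronglyHarmonicOn_of_comp {u : ℍ → EReal} {Ω : Set ℍ} (hΩ : IsOpen Ω) (hu : UscOn u Ω)
    (H : ∀ (Ω' : Set ℍ) (f : ℍ → ℍ), IsSymmetricSliceDomain Ω' → RegularOn f Ω' →
      MapsTo f Ω' Ω → SlicewiseHarmonicOn (u ∘ f) Ω') : StronglyHarmonicOn u Ω := by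
  intro I hI
  have hloc {a : ℍ} (ha : a ∈ Ω) (b : ℍ) :
      ∃ r > 0, HarmonicOn (fun z => u (a + slice I z * b)) (sliceSet I (ball 0 r)) := by
    obtain ⟨r, hr, hmaps⟩ := exists_ball_mapsTo_affine hΩ ha b
    exact ⟨r, hr, H _ _ (isSymmetricSliceDomain_ball hr) (regularOn_affine a b _) hmaps I hI⟩
  have hfin : FiniteOn u Ω := by
    intro a ha
    obtain ⟨r, hr, h⟩ := hloc ha 0
    simpa using h.1 0 (by simpa [sliceSet] using hr)
  have hline : ∀ a ∈ Ω, ∀ b : ℍ,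
      HarmonicOn (fun z => u (a + slice I z * b)) {z : ℂ | a + slice I z * b ∈ Ω} := by
    refine fun a _ b => ⟨fun z hz => hfin _ hz, fun z hz => ?_⟩
    obtain ⟨r, hr, h⟩ := hloc hz b
    have h0 : HarmonicAt (fun w => (u (a + slice I z * b + slice I w * b)).toReal) (-z + z) := by
      rw [neg_add_cancel]
      exact h.2 0 (by simpa [sliceSet] using hr)
    have h1 := h0.comp_add_left
    simpa only [← line_shift, add_neg_cancel_left] using h1
  exact ⟨hfin, contDiffOn_of_harmonicOn_lines hI hΩ hu hline, hline⟩

end Quat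

/-! ### The equivalences -/

theorem mainTheorem1 (Ω : Set ℍ) (hΩ : Quat.IsOpenDomain Ω) (u : ℍ → EReal) (hu : Quat.InUs u Ω) :
    (Quat.StronglySubharmonicOn u Ω ↔
      ∀ (Ω' : Set ℍ) (f : ℍ → ℍ), Quat.IsOpenDomain Ω' → Quat.RegularOn f Ω' → Set.MapsTo f Ω' Ω →
        Quat.SlicewiseSubharmonicOn (u ∘ f) Ω') ∧
    (Quat.StronglySubharmonicOn u Ω ↔
      ∀ (Ω' : Set ℍ) (f : ℍ → ℍ), Quat.IsSymmetricSliceDomain Ω' → Quat.RegularOn f Ω' →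
        Set.MapsTo f Ω' Ω → Quat.WeaklySubharmonicOn (u ∘ f) Ω') ∧
    (Quat.StronglyHarmonicOn u Ω ↔
      ∀ (Ω' : Set ℍ) (f : ℍ → ℍ), Quat.IsOpenDomain Ω' → Quat.RegularOn f Ω' → Set.MapsTo f Ω' Ω →
        Quat.SlicewiseHarmonicOn (u ∘ f) Ω') ∧
    (Quat.StronglyHarmonicOn u Ω ↔
      ∀ (Ω' : Set ℍ) (f : ℍ → ℍ), Quat.IsSymmetricSliceDomain Ω' → Quat.RegularOn f Ω' →
        Set.MapsTo f Ω' Ω → Quat.WeaklyHarmonicOn (u ∘ f) Ω') := by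
  have harm (h : Quat.StronglyHarmonicOn u Ω) {Ω' : Set ℍ} {f : ℍ → ℍ} (hΩ' : IsOpen Ω')
      (hf : Quat.RegularOn f Ω') (hm : Set.MapsTo f Ω' Ω) :
      Quat.SlicewiseHarmonicOn (u ∘ f) Ω' := fun I hI =>
    (h I hI).harmonicOn_comp hI hΩ.1 (Quat.isOpen_sliceSet I hΩ')
      (hf.sliceHolomorphicOn hΩ' hI) fun _ hz => hm hz
  refine ⟨⟨fun h Ω' f hΩ' hf hm => h.slicewiseSubharmonicOn_comp hΩ.1 hΩ'.1 hf hm, fun H => ?_⟩,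
    ⟨fun h Ω' f hΩ' hf hm => ⟨hu.1.comp (hf.continuousOn hΩ') hm,
      h.slicewiseSubharmonicOn_comp hΩ.1 hΩ'.isOpenDomain.1 hf hm⟩, fun H => ?_⟩,
    ⟨fun h Ω' f hΩ' hf hm => harm h hΩ'.1 hf hm, fun H => ?_⟩,
    ⟨fun h Ω' f hΩ' hf hm => ⟨hu.1.comp (hf.continuousOn hΩ') hm,
      harm h hΩ'.isOpenDomain.1 hf hm⟩, fun H => ?_⟩⟩
  · exact Quat.stronglySubharmonicOn_of_comp hΩ.1 hu fun Ω' f hΩ' => H Ω' f hΩ'.isOpenDomain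
  · exact Quat.stronglySubharmonicOn_of_comp hΩ.1 hu fun Ω' f hΩ' hf hm => (H Ω' f hΩ' hf hm).2
  · exact Quat.stronglyHarmonicOn_of_comp hΩ.1 hu.1 fun Ω' f hΩ' => H Ω' f hΩ'.isOpenDomain
  · exact Quat.stronglyHarmonicOn_of_comp hΩ.1 hu.1 fun Ω' f hΩ' hf hm => (H Ω' f hΩ' hf hm).2
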